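/- Let $A\in\mathbb{R}^{n\times n}$ be symmetric positive definite with bandwidth $\beta_A\ge 1$ (i.e. $(A)_{p,q}=0$ whenever $|p-q|>\beta_A$), let $D\in\mathbb{R}^{n\times n}$ be symmetric and banded with bandwidth $\beta_D$, and let $\lambda_{\min}(A)$, $\lambda_{\max}(A)$ denote the smallest and largest eigenvalues of $A$; assume $\lambda_{\min}(A)<\lambda_{\max}(A)$. For $\omega\in\mathbb{R}$ define $$\lambda_1=\lambda_1(\omega):=\lambda_{\min}(A)+i\omega,\quad \lambda_2=\lambda_2(\omega):=\lambda_{\max}(A)+i\omega,\quad \alpha=\alpha(\omega):=\frac{|\lambda_1|+|\lambda_2|}{|\lambda_2-\lambda_1|},\quad R=R(\omega):=\alpha+\sqrt{\alpha^2-1}$$ (here $i$ is the imaginary unit). Then the Lyapunov equation $AX+XA=D$ has a unique solution $X\in\mathbb{R}^{n\times n}$, and for all $i,j\in\{1,\dots,n\}$ $$|(X)_{i,j}|\le\sum_{k=1}^n\sum_{\ell=1}^n\theta_{k,\ell}\,|(D)_{k,\ell}|,$$ where the weights $\theta_{k,\ell}$ (which depend on $A$, $\beta_A$, $i$ and $j$)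 are as follows, all integrals being finite. - If $k\neq i$ and $\ell\neq j$, then $$\theta_{k,\ell}=\frac{64}{2\pi|\lambda_{\max}(A)-\lambda_{\min}(A)|^2}\int_{-\infty}^{\infty}\left(\frac{R^2}{(R^2-1)^2}\right)^2\left(\frac1R\right)^{\frac{|k-i|}{\beta_A}+\frac{|\ell-j|}{\beta_A}-2}d\omega.$$ - If exactly one of $k=i$, $\ell=j$ holds, then $$\theta_{k,\ell}=\frac{8}{2\pi|\lambda_{\max}(A)-\lambda_{\min}(A)|}\int_{-\infty}^{\infty}\frac{1}{\sqrt{\lambda_{\min}(A)^2+\omega^2}}\,\frac{R^2}{(R^2-1)^2}\left(\frac1R\right)^{\frac{|k-i|}{\beta_A}+\frac{|\ell-j|}{\beta_A}-1}d\omega.$$ - If $k=i$ and $\ell=j$, then $$\theta_{k,\ell}=\frac{1}{2\lambda_{\min}(A)}.$$ -/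

import Mathlib

open MeasureTheory

noncomputable section

/-- The square matrix `T` has bandwidth (at most) `b`: its `(i,j)` entry vanishes
whenever `|i - j| > b`. -/
def IsBanded {n : ℕ} (T : Matrix (Fin n) (Fin n) ℝ) (b : ℕ) : Prop :=
  ∀ i j : Fin n, (b : ℤ) < |((i : ℕ) : ℤ) - ((j : ℕ) : ℤ)| → T i j = 0

/-- The smallest eigenvalue of `T` (for `T` symmetric and of positive size, where the spectrum is
a finite nonempty set of real numbers). -/
def lambdaMin {n : ℕ} (T : Matrix (Fin n) (Fin n) ℝ) : ℝ := sInf (spectrum ℝ T)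

/-- The largest eigenvalue of `T` (for `T` symmetric and of positive size). -/
def lambdaMax {n : ℕ} (T : Matrix (Fin n) (Fin n) ℝ) : ℝ := sSup (spectrum ℝ T)

/-- `λ₁(ω) = λ_min(A) + i ω`. -/
def lambda1 {n : ℕ} (A : Matrix (Fin n) (Fin n) ℝ) (ω : ℝ) : ℂ :=
  (lambdaMin A : ℂ) + Complex.I * (ω : ℂ)

/-- `λ₂(ω) = λ_max(A) + i ω`. -/
def lambda2 {n : ℕ} (A : Matrix (Fin n) (Fin n) ℝ) (ω : ℝ) : ℂ :=
  (lambdaMax A : ℂ) + Complex.I * (ω : ℂ)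

/-- `α(ω) = (|λ₁| + |λ₂|) / |λ₂ - λ₁|`. -/
def alphaFun {n : ℕ} (A : Matrix (Fin n) (Fin n) ℝ) (ω : ℝ) : ℝ :=
  (‖lambda1 A ω‖ + ‖lambda2 A ω‖) / ‖lambda2 A ω - lambda1 A ω‖

/-- `R(ω) = α + √(α² - 1)`. -/
def RFun {n : ℕ} (A : Matrix (Fin n) (Fin n) ℝ) (ω : ℝ) : ℝ :=
  alphaFun A ω + Real.sqrt (alphaFun A ω ^ 2 - 1)

/-- The scaled index distance `|p - q| / β`, a real number. -/
def scaledDist {n : ℕ} (b : ℕ) (p q : Fin n) : ℝ :=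
  |((p : ℕ) : ℝ) - ((q : ℕ) : ℝ)| / (b : ℝ)

/-- The integrand of the weight `θ_{k,ℓ}` when `k ≠ i` and `ℓ ≠ j`. -/
def integrandOff {n : ℕ} (A : Matrix (Fin n) (Fin n) ℝ) (b : ℕ) (i j k l : Fin n) (ω : ℝ) : ℝ :=
  (RFun A ω ^ 2 / (RFun A ω ^ 2 - 1) ^ 2) ^ 2
    * (1 / RFun A ω) ^ (scaledDist b k i + scaledDist b l j - 2)

/-- The integrand of the weight `θ_{k,ℓ}` when exactly one of `k = i`, `ℓ = j` holds. -/
def integrandOne {n : ℕ} (A : Matrix (Fin n) (Fin n) ℝ) (b : ℕ) (i j k l : Fin n) (ω : ℝ) : ℝ :=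
  1 / Real.sqrt (lambdaMin A ^ 2 + ω ^ 2)
    * (RFun A ω ^ 2 / (RFun A ω ^ 2 - 1) ^ 2)
    * (1 / RFun A ω) ^ (scaledDist b k i + scaledDist b l j - 1)

/-- The weight `θ_{k,ℓ}` (depending also on `i` and `j`) in the bound for the `(i,j)` entry. -/
def theta {n : ℕ} (A : Matrix (Fin n) (Fin n) ℝ) (b : ℕ) (i j k l : Fin n) : ℝ :=
  if k = i ∧ l = j then
    1 / (2 * lambdaMin A)
  else if k = i ∨ l = j then
    8 / (2 * Real.pi * |lambdaMax A - lambdaMin A|) * ∫ ω : ℝ, integrandOne A b i j k l ω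
  else
    64 / (2 * Real.pi * |lambdaMax A - lambdaMin A| ^ 2) * ∫ ω : ℝ, integrandOff A b i j k l ω

end

/-! Write A = U diag(μ) Uᵀ. In the eigenbasis the equation decouples, since A acts on the two sides
of X through the factor μ_s + μ_t > 0; this gives existence, uniqueness and X_ij = ∑ K(i,j,k,l) D_kl
(`lyapunov_iff_of_diagonalization`, `lyapunov_solution_apply`). It remains to show |K| ≤ θ.

Because 1/(μ_s + μ_t) = (2π)⁻¹ ∫ Re((μ_s + iω)⁻¹ conj((μ_t + iω)⁻¹)) dω, the kernel K is an integral
over ω of a product of one (i,k) and one conjugated (j,l) entry of the resolvent (A + iω)⁻¹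
(`lyapunovKernel_eq_integral`). A diagonal entry is at most 1/√(λ_min² + ω²). For an off-diagonal
entry, any polynomial p of degree m with mβ < |i - k| has p(A)_ik = 0, so the entry is bounded by
the uniform error of approximating 1/(x + iω) by p on [λ_min, λ_max]
(`norm_spectralEntry_resolvent_le`).

The approximation is explicit. After rescaling to [-1, 1] the pole is a = (w + w⁻¹)/2 with |w| = R.
A combination G of three consecutive Chebyshev polynomials satisfies |G(x)| ≤ 2|x - a| on [-1, 1],
while |G(a)| grows like R^m; then p = (1 - G/G(a))/(x - a) has error G(x)/((x - a) G(a))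
(`exists_polynomial_approx_inv_sub`). -/

/-! ### The Joukowski map. -/

open Polynomial in
/-- Chebyshev polynomials of the first kind in the Joukowski variable. -/
theorem chebyshevT_eval_joukowski {u : ℂ} (hu : u ≠ 0) (k : ℤ) :
    (Chebyshev.T ℂ k).eval ((u + u⁻¹) / 2) = (u ^ k + u ^ (-k)) / 2 := by
  -- With the complex angle t = -i log u, so that u = exp(it), the claim becomes T_k(cos t) =
  -- cos(kt).
  have h1 : Complex.exp (-Complex.I * Complex.log u * Complex.I) = u := by
    rw [show -Complex.I * Complex.log u * Complex.I = Complex.log u by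
      linear_combination (-Complex.log u) * Complex.I_mul_I, Complex.exp_log hu]
  have hcos : (u + u⁻¹) / 2 = Complex.cos (-Complex.I * Complex.log u) := by
    rw [Complex.cos, neg_mul (-Complex.I * Complex.log u), Complex.exp_neg, h1]
  rw [hcos, Chebyshev.T_complex_cos, Complex.cos, neg_mul (k * (-Complex.I * Complex.log u)),
    Complex.exp_neg, mul_assoc, Complex.exp_int_mul, h1, zpow_neg]

/-- The two preimages of a are mutually inverse, so one of them lies outside the open unit disc. -/
theorem Complex.exists_joukowski (a : ℂ) :
    ∃ w : ℂ, 1 ≤ ‖w‖ ∧ a = (w + w⁻¹) / 2 := by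
  obtain ⟨t, rfl⟩ := Complex.cos_surjective a
  rcases le_total 1 ‖Complex.exp (t * Complex.I)‖ with h | h
  · exact ⟨_, h, by rw [Complex.cos, neg_mul, Complex.exp_neg]⟩
  · refine ⟨(Complex.exp (t * Complex.I))⁻¹, ?_, ?_⟩
    · rw [norm_inv]
      exact (one_le_inv₀ (by simp [Complex.exp_ne_zero])).2 h
    · rw [Complex.cos, neg_mul, Complex.exp_neg, inv_inv, add_comm]

/-- The distances to the foci are |w ∓ 1|²/(2|w|), and the parallelogram law adds them. -/
theorem norm_joukowski_sub_one_add_norm_add_one {w : ℂ} (hw : w ≠ 0) :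
    ‖(w + w⁻¹) / 2 - 1‖ + ‖(w + w⁻¹) / 2 + 1‖ = ‖w‖ + ‖w‖⁻¹ := by
  have h1 : (w + w⁻¹) / 2 - 1 = (w - 1) ^ 2 / (2 * w) := by field_simp; ring
  have h2 : (w + w⁻¹) / 2 + 1 = (w + 1) ^ 2 / (2 * w) := by field_simp; ring
  have hp := parallelogram_law_with_norm ℝ w 1
  have hw' : ‖w‖ ≠ 0 := norm_ne_zero_iff.2 hw
  rw [h1, h2, norm_div, norm_div, norm_pow, norm_pow, norm_mul, Complex.norm_ofNat]
  rw [norm_one] at hp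
  field_simp
  linarith

/-- The modulus of the Joukowski preimage outside the unit disc, in terms of the semi-major axis
of the ellipse with foci `±1` through the point. -/
theorem norm_eq_of_joukowski {w : ℂ} {α : ℝ} (hw : 1 ≤ ‖w‖)
    (hα : ‖(w + w⁻¹) / 2 - 1‖ + ‖(w + w⁻¹) / 2 + 1‖ = 2 * α) :
    ‖w‖ = α + Real.sqrt (α ^ 2 - 1) := by
  have hw0 : w ≠ 0 := by
    rintro rfl
    norm_num at hw
  rw [norm_joukowski_sub_one_add_norm_add_one hw0] at hα
  have hinv : ‖w‖⁻¹ ≤ ‖w‖ := (inv_le_one_of_one_le₀ hw).trans hw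
  have hmul : ‖w‖ * ‖w‖⁻¹ = 1 := mul_inv_cancel₀ (by positivity)
  have hsq : α ^ 2 - 1 = ((‖w‖ - ‖w‖⁻¹) / 2) ^ 2 := by
    rw [show α = (‖w‖ + ‖w‖⁻¹) / 2 by linarith]
    linear_combination hmul
  rw [hsq, Real.sqrt_sq (by linarith)]
  linarith

theorem joukowski_sub_joukowski {u w : ℂ} (hu : u ≠ 0) (hw : w ≠ 0) :
    (u + u⁻¹) / 2 - (w + w⁻¹) / 2 = -((w - u) * (1 - u⁻¹ * w⁻¹)) / 2 := by
  field_simp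
  ring

/-- On the unit circle 1 - w̄u = u · conj(u - w). This is why w̄, rather than w, enters
`resolventNumerator`. -/
theorem norm_one_sub_conj_mul {u : ℂ} (hu : ‖u‖ = 1) (w : ℂ) :
    ‖1 - (starRingEnd ℂ) w * u‖ = ‖w - u‖ := by
  have h : u * (starRingEnd ℂ) u = 1 := by
    rw [Complex.mul_conj, Complex.normSq_eq_norm_sq, hu]; simp
  have : 1 - (starRingEnd ℂ) w * u = u * (starRingEnd ℂ) (u - w) := by
    rw [map_sub]
    linear_combination -h
  rw [this, norm_mul, hu, one_mul, Complex.norm_conj, norm_sub_rev]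

/-! ### Polynomial approximation of 1/(x - a). -/

open Polynomial in
/-- The numerator of the error of the polynomial approximation of degree `m` to `1 / (x - a)`
on `[-1, 1]`, where `a = (w + w⁻¹) / 2`. -/
noncomputable def resolventNumerator (w : ℂ) (m : ℕ) : ℂ[X] :=
  C ((starRingEnd ℂ) w) * Chebyshev.T ℂ (m + 1) - C (1 + (starRingEnd ℂ) w / w) * Chebyshev.T ℂ m
    + C w⁻¹ * Chebyshev.T ℂ (m - 1)

open Polynomial in
theorem natDegree_resolventNumerator_le (w : ℂ) (m : ℕ) :
    (resolventNumerator w m).natDegree ≤ m + 1 := by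
  unfold resolventNumerator
  refine natDegree_add_le_of_degree_le ((natDegree_sub_le_of_le ?_ ?_).trans_eq (max_self _)) ?_ <;>
  · refine (natDegree_C_mul_le _ _).trans ?_
    -- The Chebyshev index is an integer: for m = 0 the last term is T₋₁ = T₁, still of degree at
    -- most m + 1.
    rw [Chebyshev.natDegree_T]
    omega

/-- The two summands are exchanged by u ↦ u⁻¹. For |u| = 1 each has modulus 2|x - a|; at u = w the
second vanishes, and only the growing one is left. -/
theorem resolventNumerator_eval {w u : ℂ} (hw : w ≠ 0) (hu : u ≠ 0) (m : ℕ) :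
    (resolventNumerator w m).eval ((u + u⁻¹) / 2) =
      -(u ^ m * ((1 - (starRingEnd ℂ) w * u) * (1 - u⁻¹ * w⁻¹))
        + (u⁻¹) ^ m * ((1 - (starRingEnd ℂ) w * u⁻¹) * (1 - u * w⁻¹))) / 2 := by
  simp only [resolventNumerator, Polynomial.eval_add, Polynomial.eval_sub, Polynomial.eval_mul,
    Polynomial.eval_C, chebyshevT_eval_joukowski hu, zpow_neg, zpow_add₀ hu, zpow_sub₀ hu,
    zpow_natCast, zpow_one, inv_pow]
  field_simp
  ring

theorem norm_resolventNumerator_eval_le {w : ℂ} (hw : w ≠ 0) (m : ℕ) {x : ℝ}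
    (hx : x ∈ Set.Icc (-1 : ℝ) 1) :
    ‖(resolventNumerator w m).eval (x : ℂ)‖ ≤ 2 * ‖(x : ℂ) - (w + w⁻¹) / 2‖ := by
  set u : ℂ := Complex.exp (Real.arccos x * Complex.I) with hudef
  have hu : u ≠ 0 := Complex.exp_ne_zero _
  have hun : ‖u‖ = 1 := Complex.norm_exp_ofReal_mul_I _
  have hun' : ‖u⁻¹‖ = 1 := by rw [norm_inv, hun, inv_one]
  have hxu : (x : ℂ) = (u + u⁻¹) / 2 := by
    conv_lhs => rw [← Real.cos_arccos hx.1 hx.2]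
    rw [Complex.ofReal_cos, Complex.cos, neg_mul, Complex.exp_neg]
  have e1 : ‖(x : ℂ) - (w + w⁻¹) / 2‖ = ‖w - u‖ * ‖1 - u⁻¹ * w⁻¹‖ / 2 := by
    rw [hxu, joukowski_sub_joukowski hu hw, norm_div, norm_neg, norm_mul, Complex.norm_ofNat]
  -- The point x is unchanged by u ↦ u⁻¹, so |x - a| has a second factorization, matching the second
  -- summand.
  have e2 : ‖(x : ℂ) - (w + w⁻¹) / 2‖ = ‖w - u⁻¹‖ * ‖1 - u * w⁻¹‖ / 2 := by
    have h := joukowski_sub_joukowski (inv_ne_zero hu) hw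
    rw [inv_inv, add_comm u⁻¹ u] at h
    rw [hxu, h, norm_div, norm_neg, norm_mul, Complex.norm_ofNat]
  have h1 : ‖u ^ m * ((1 - (starRingEnd ℂ) w * u) * (1 - u⁻¹ * w⁻¹))‖
      = 2 * ‖(x : ℂ) - (w + w⁻¹) / 2‖ := by
    rw [norm_mul, norm_mul, norm_pow, hun, one_pow, norm_one_sub_conj_mul hun, e1]; ring
  have h2 : ‖(u⁻¹) ^ m * ((1 - (starRingEnd ℂ) w * u⁻¹) * (1 - u * w⁻¹))‖
      = 2 * ‖(x : ℂ) - (w + w⁻¹) / 2‖ := by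
    rw [norm_mul, norm_mul, norm_pow, hun', one_pow, norm_one_sub_conj_mul hun', e2]; ring
  conv_lhs => rw [hxu]
  rw [resolventNumerator_eval hw hu, norm_div, norm_neg, Complex.norm_ofNat]
  have := norm_add_le (u ^ m * ((1 - (starRingEnd ℂ) w * u) * (1 - u⁻¹ * w⁻¹)))
    ((u⁻¹) ^ m * ((1 - (starRingEnd ℂ) w * u⁻¹) * (1 - u * w⁻¹)))
  rw [h1, h2] at this
  linarith

theorem le_norm_resolventNumerator_eval {w : ℂ} (hw : 1 < ‖w‖) (m : ℕ) :
    ‖w‖ ^ m * (‖w‖ ^ 2 - 1) ^ 2 / (2 * ‖w‖ ^ 2) ≤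
      ‖(resolventNumerator w m).eval ((w + w⁻¹) / 2)‖ := by
  have hw0 : w ≠ 0 := by
    rintro rfl
    norm_num at hw
  have hR : 0 < ‖w‖ := by linarith
  rw [resolventNumerator_eval hw0 hw0, mul_inv_cancel₀ hw0, sub_self, mul_zero, mul_zero, add_zero,
    norm_div, norm_neg, norm_mul, norm_mul, norm_pow, Complex.norm_ofNat]
  have h1 : ‖w‖ ^ 2 - 1 ≤ ‖1 - (starRingEnd ℂ) w * w‖ := by
    have := norm_sub_norm_le ((starRingEnd ℂ) w * w) 1
    rwa [norm_mul, Complex.norm_conj, norm_one, ← sq, norm_sub_rev] at this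
  have h2 : (‖w‖ ^ 2 - 1) / ‖w‖ ^ 2 ≤ ‖1 - w⁻¹ * w⁻¹‖ := by
    have := norm_sub_norm_le 1 (w⁻¹ * w⁻¹)
    rw [norm_mul, norm_inv, norm_one] at this
    refine le_trans (le_of_eq ?_) this
    field_simp
  have h0 : 0 ≤ ‖w‖ ^ 2 - 1 := by nlinarith
  calc ‖w‖ ^ m * (‖w‖ ^ 2 - 1) ^ 2 / (2 * ‖w‖ ^ 2)
      = ‖w‖ ^ m * ((‖w‖ ^ 2 - 1) * ((‖w‖ ^ 2 - 1) / ‖w‖ ^ 2)) / 2 := by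
        field_simp
    _ ≤ _ := by gcongr

open Polynomial in
/-- Polynomial approximation of `1 / (x - a)` on `[-1, 1]` for complex `a = (w + w⁻¹) / 2`. -/
theorem exists_polynomial_approx_inv_sub {w : ℂ} (hw : 1 < ‖w‖) (m : ℕ) :
    ∃ p : ℂ[X], p.natDegree ≤ m ∧ ∀ x ∈ Set.Icc (-1 : ℝ) 1, (x : ℂ) ≠ (w + w⁻¹) / 2 →
      ‖((x : ℂ) - (w + w⁻¹) / 2)⁻¹ - p.eval (x : ℂ)‖
        ≤ 4 * (‖w‖ ^ 2 / (‖w‖ ^ 2 - 1) ^ 2) * (1 / ‖w‖) ^ m := by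
  have hw0 : w ≠ 0 := by
    rintro rfl
    norm_num at hw
  have hR : 0 < ‖w‖ := by linarith
  have hR2 : 0 < ‖w‖ ^ 2 - 1 := by nlinarith
  set a : ℂ := (w + w⁻¹) / 2 with ha
  set G := resolventNumerator w m with hG
  have hlow := le_norm_resolventNumerator_eval hw m
  have hGpos : 0 < ‖G.eval a‖ := lt_of_lt_of_le (by positivity) hlow
  have hGa : G.eval a ≠ 0 := norm_pos_iff.1 hGpos
  -- H vanishes at a, hence is divisible by X - a; the quotient, of degree at most m, is the
  -- approximant.
  set H : ℂ[X] := 1 - C (G.eval a)⁻¹ * G with hH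
  have hroot : H.IsRoot a := by simp [hH, hGa]
  have hfac := mul_divByMonic_eq_iff_isRoot.2 hroot
  have hdeg : H.natDegree ≤ m + 1 := by
    exact (natDegree_sub_le_of_le (natDegree_one.trans_le (Nat.zero_le _))
      ((natDegree_C_mul_le _ _).trans (natDegree_resolventNumerator_le w m))).trans_eq (max_self _)
  refine ⟨H /ₘ (X - C a), ?_, fun x hx hxa => ?_⟩
  · rw [natDegree_divByMonic _ (monic_X_sub_C a), natDegree_X_sub_C]
    omega
  · have hxa' : (x : ℂ) - a ≠ 0 := sub_ne_zero.2 hxa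
    have hev : ((x : ℂ) - a) * (H /ₘ (X - C a)).eval (x : ℂ) = 1 - (G.eval a)⁻¹ * G.eval (x : ℂ) := by
      have := congrArg (eval (x : ℂ)) hfac
      simpa [hH] using this
    have herr : ((x : ℂ) - a)⁻¹ - (H /ₘ (X - C a)).eval (x : ℂ)
        = G.eval (x : ℂ) / (((x : ℂ) - a) * G.eval a) := by
      rw [← mul_right_inj' hxa', mul_sub, hev]
      field_simp
      ring
    have hup := norm_resolventNumerator_eval_le hw0 m hx
    have hxn : 0 < ‖(x : ℂ) - a‖ := norm_pos_iff.2 hxa'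
    rw [herr, norm_div, norm_mul]
    calc ‖G.eval (x : ℂ)‖ / (‖(x : ℂ) - a‖ * ‖G.eval a‖)
        ≤ 2 * ‖(x : ℂ) - a‖ / (‖(x : ℂ) - a‖ *
            (‖w‖ ^ m * (‖w‖ ^ 2 - 1) ^ 2 / (2 * ‖w‖ ^ 2))) := by
          gcongr
      _ = _ := by
          rw [one_div, inv_pow]
          field_simp
          ring

/-! ### Transfer to an interval of positive reals. -/

theorem Complex.norm_ofReal_add_I_mul (x ω : ℝ) :
    ‖(x : ℂ) + Complex.I * (ω : ℂ)‖ = Real.sqrt (x ^ 2 + ω ^ 2) := by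
  rw [mul_comm, Complex.norm_add_mul_I]

theorem le_norm_ofReal_add_I_mul (x ω : ℝ) : x ≤ ‖(x : ℂ) + Complex.I * (ω : ℂ)‖ := by
  rw [Complex.norm_ofReal_add_I_mul]
  exact Real.le_sqrt_of_sq_le (by nlinarith [sq_nonneg ω])

/-- The normalised semi-axis `α` exceeds `1` when the segment lies in the right half plane. -/
theorem one_lt_of_mul_eq_norm_add_norm {a b ω α : ℝ} (ha : 0 < a) (hab : a < b)
    (hα : α * (b - a) = ‖(a : ℂ) + Complex.I * ω‖ + ‖(b : ℂ) + Complex.I * ω‖) : 1 < α := by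
  have h1 := le_norm_ofReal_add_I_mul a ω
  have h2 := le_norm_ofReal_add_I_mul b ω
  have h3 : 0 < b - a := by linarith
  by_contra h
  nlinarith

open Polynomial in
/-- Polynomial approximation of `1 / (μ + iω)` on an interval `[a, b]` of positive reals. -/
theorem exists_polynomial_approx_resolvent {a b ω α R : ℝ} (ha : 0 < a) (hab : a < b)
    (hα : α * (b - a) = ‖(a : ℂ) + Complex.I * ω‖ + ‖(b : ℂ) + Complex.I * ω‖)
    (hR : R = α + Real.sqrt (α ^ 2 - 1)) (m : ℕ) :
    ∃ p : ℂ[X], p.natDegree ≤ m ∧ ∀ x ∈ Set.Icc a b,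
      ‖((x : ℂ) + Complex.I * ω)⁻¹ - p.eval (x : ℂ)‖
        ≤ 8 / (b - a) * (R ^ 2 / (R ^ 2 - 1) ^ 2) * (1 / R) ^ m := by
  have hd : 0 < b - a := by linarith
  have hdC : (b : ℂ) - a ≠ 0 := by exact_mod_cast hd.ne'
  have hdn : ‖(b : ℂ) - a‖ = b - a := by
    rw [← Complex.ofReal_sub, Complex.norm_of_nonneg hd.le]
  -- This is the image of the pole -iω under the affine map of [a, b] onto [-1, 1]. Its distances to
  -- 1 and -1 are 2|b + iω|/(b - a) and 2|a + iω|/(b - a), with sum 2α.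
  obtain ⟨w, hw1, hw⟩ := Complex.exists_joukowski (-(a + b + 2 * Complex.I * ω) / (b - a))
  have hsum : ‖(w + w⁻¹) / 2 - 1‖ + ‖(w + w⁻¹) / 2 + 1‖ = 2 * α := by
    have e1 : (w + w⁻¹) / 2 - 1 = -(2 * (b + Complex.I * ω)) / (b - a) := by
      rw [← hw]; field_simp; ring
    have e2 : (w + w⁻¹) / 2 + 1 = -(2 * (a + Complex.I * ω)) / (b - a) := by
      rw [← hw]; field_simp; ring
    rw [e1, e2, norm_div, norm_div, norm_neg, norm_neg, norm_mul, norm_mul, Complex.norm_ofNat, hdn]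
    field_simp
    linarith
  have hwR : ‖w‖ = R := (norm_eq_of_joukowski hw1 hsum).trans hR.symm
  have hα1 := one_lt_of_mul_eq_norm_add_norm ha hab hα
  have hR1 : 1 < ‖w‖ := by
    rw [hwR, hR]
    linarith [Real.sqrt_nonneg (α ^ 2 - 1)]
  obtain ⟨p, hp, hap⟩ := exists_polynomial_approx_inv_sub hR1 m
  refine ⟨C (2 / ((b : ℂ) - a)) * p.comp (C (2 / ((b : ℂ) - a)) * X + C (-(((a : ℂ) + b) / (b - a)))),
    ?_, fun x hx => ?_⟩
  · refine (natDegree_C_mul_le _ _).trans (natDegree_comp_le.trans ?_)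
    exact (Nat.mul_le_mul hp natDegree_linear_le).trans_eq (mul_one m)
  · have hx0 : (x : ℂ) + Complex.I * ω ≠ 0 := by
      intro h
      have := le_norm_ofReal_add_I_mul x ω
      rw [h, norm_zero] at this
      linarith [hx.1]
    have hy : (2 * x - (a + b)) / (b - a) ∈ Set.Icc (-1 : ℝ) 1 := by
      constructor
      · rw [le_div_iff₀ hd]; linarith [hx.1]
      · rw [div_le_iff₀ hd]; linarith [hx.2]
    have hyw : (((2 * x - (a + b)) / (b - a) : ℝ) : ℂ) - (w + w⁻¹) / 2
        = 2 / (b - a) * (x + Complex.I * ω) := by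
      rw [← hw]; push_cast; field_simp; ring
    have hne : (((2 * x - (a + b)) / (b - a) : ℝ) : ℂ) ≠ (w + w⁻¹) / 2 := by
      rw [← sub_ne_zero, hyw]
      exact mul_ne_zero (div_ne_zero two_ne_zero hdC) hx0
    have hb := hap _ hy hne
    rw [hyw, hwR] at hb
    have harg : 2 / ((b : ℂ) - a) * x + -((a + b) / (b - a))
        = (((2 * x - (a + b)) / (b - a) : ℝ) : ℂ) := by
      push_cast; field_simp; ring
    have herr : ((x : ℂ) + Complex.I * ω)⁻¹ - (C (2 / ((b : ℂ) - a)) *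
        p.comp (C (2 / ((b : ℂ) - a)) * X + C (-(((a : ℂ) + b) / (b - a))))).eval (x : ℂ)
        = 2 / (b - a) * ((2 / (b - a) * (x + Complex.I * ω))⁻¹
          - p.eval (((2 * x - (a + b)) / (b - a) : ℝ) : ℂ)) := by
      simp only [eval_mul, eval_C, eval_comp, eval_add, eval_X, harg]
      field_simp
    rw [herr, norm_mul, norm_div, Complex.norm_ofNat, hdn]
    -- The constant 8 is 4 times the scaling factor 2/(b - a) of the affine map.
    calc _ ≤ 2 / (b - a) * (4 * (R ^ 2 / (R ^ 2 - 1) ^ 2) * (1 / R) ^ m) := by gcongr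
      _ = _ := by ring

/-! ### Banded matrices and decay of the resolvent. -/

theorem IsBanded.mul {n : ℕ} {S T : Matrix (Fin n) (Fin n) ℝ} {b c : ℕ} (hS : IsBanded S b)
    (hT : IsBanded T c) : IsBanded (S * T) (b + c) := by
  intro i j hij
  rw [Matrix.mul_apply]
  refine Finset.sum_eq_zero fun k _ => ?_
  by_cases h : (b : ℤ) < |((i : ℕ) : ℤ) - ((k : ℕ) : ℤ)|
  · rw [hS i k h, zero_mul]
  · rw [hT k j ?_, mul_zero]
    have := abs_sub_le (((i : ℕ) : ℤ)) ((k : ℕ) : ℤ) ((j : ℕ) : ℤ)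
    push_cast at hij
    omega

theorem IsBanded.pow {n : ℕ} {T : Matrix (Fin n) (Fin n) ℝ} {b : ℕ} (hT : IsBanded T b) (r : ℕ) :
    IsBanded (T ^ r) (r * b) := by
  induction r with
  | zero =>
    intro i j hij
    rw [pow_zero, Matrix.one_apply_ne]
    rintro rfl
    simp at hij
  | succ r ih =>
    rw [pow_succ, Nat.succ_mul]
    exact ih.mul hT

/-- The entries of `f(A)` for `A = U diag(μ) Uᵀ`. -/
noncomputable def spectralEntry {n : ℕ} (U : Matrix (Fin n) (Fin n) ℝ) (μ : Fin n → ℝ) (f : ℝ → ℂ)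
    (i k : Fin n) : ℂ :=
  ∑ s, ((U i s * U k s : ℝ) : ℂ) * f (μ s)

section

open Matrix

variable {n : ℕ} {U : Matrix (Fin n) (Fin n) ℝ} {μ : Fin n → ℝ}

theorem sum_sq_row_eq_one (hU : U * Uᵀ = 1) (i : Fin n) : ∑ s, U i s ^ 2 = 1 := by
  have := congrFun (congrFun hU i) i
  simpa [Matrix.mul_apply, sq] using this

/-- Cauchy–Schwarz for unit rows, in its arithmetic–geometric mean form. It bounds every entry of
f(A) by the supremum of |f| on the spectrum. -/
theorem sum_abs_mul_row_le_one (hU : U * Uᵀ = 1) (i k : Fin n) : ∑ s, |U i s * U k s| ≤ 1 := by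
  calc ∑ s, |U i s * U k s| ≤ ∑ s, (U i s ^ 2 + U k s ^ 2) / 2 := by
        refine Finset.sum_le_sum fun s _ => ?_
        rw [abs_le]
        constructor <;> nlinarith [sq_nonneg (U i s + U k s), sq_nonneg (U i s - U k s)]
    _ = 1 := by
        rw [← Finset.sum_div, Finset.sum_add_distrib, sum_sq_row_eq_one hU, sum_sq_row_eq_one hU]
        norm_num

theorem norm_spectralEntry_le (hU : U * Uᵀ = 1) {f : ℝ → ℂ} {M : ℝ}
    (hf : ∀ s, ‖f (μ s)‖ ≤ M) (hM : 0 ≤ M) (i k : Fin n) : ‖spectralEntry U μ f i k‖ ≤ M := by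
  calc ‖spectralEntry U μ f i k‖ ≤ ∑ s, |U i s * U k s| * M := by
        refine norm_sum_le_of_le _ fun s _ => ?_
        rw [norm_mul, Complex.norm_real, Real.norm_eq_abs]
        exact mul_le_mul_of_nonneg_left (hf s) (abs_nonneg _)
    _ ≤ 1 * M := by
        rw [← Finset.sum_mul]
        exact mul_le_mul_of_nonneg_right (sum_abs_mul_row_le_one hU i k) hM
    _ = M := one_mul M

theorem pow_apply_eq_sum_of_diagonalization {A : Matrix (Fin n) (Fin n) ℝ} (hU' : Uᵀ * U = 1)
    (hU : U * Uᵀ = 1) (hA : A = U * diagonal μ * Uᵀ) (r : ℕ) (i k : Fin n) :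
    (A ^ r) i k = ∑ s, U i s * U k s * μ s ^ r := by
  have hpow : A ^ r = U * diagonal μ ^ r * Uᵀ := by
    induction r with
    | zero => rw [pow_zero, pow_zero, mul_one, hU]
    | succ r ih =>
      rw [pow_succ, ih, hA, pow_succ]
      calc U * diagonal μ ^ r * Uᵀ * (U * diagonal μ * Uᵀ)
          = U * diagonal μ ^ r * (Uᵀ * U) * diagonal μ * Uᵀ := by simp only [mul_assoc]
        _ = _ := by rw [hU', mul_one, mul_assoc U]
  rw [hpow, diagonal_pow, mul_apply]
  refine Finset.sum_congr rfl fun s _ => ?_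
  rw [mul_diagonal, transpose_apply, Pi.pow_apply]
  ring

/-- Low degree polynomials of a banded matrix have vanishing entries far from the diagonal. -/
theorem spectralEntry_polynomial_eq_zero {A : Matrix (Fin n) (Fin n) ℝ} (hU' : Uᵀ * U = 1)
    (hU : U * Uᵀ = 1) (hA : A = U * diagonal μ * Uᵀ) {b m : ℕ} (hb : IsBanded A b)
    {p : Polynomial ℂ} (hp : p.natDegree ≤ m) {i k : Fin n}
    (hik : ((m * b : ℕ) : ℤ) < |((i : ℕ) : ℤ) - ((k : ℕ) : ℤ)|) :
    spectralEntry U μ (fun x => p.eval (x : ℂ)) i k = 0 := by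
  have hsum : spectralEntry U μ (fun x => p.eval (x : ℂ)) i k
      = ∑ r ∈ Finset.range (m + 1), p.coeff r * (((A ^ r) i k : ℝ) : ℂ) := by
    simp only [spectralEntry, pow_apply_eq_sum_of_diagonalization hU' hU hA,
      Polynomial.eval_eq_sum_range' (Nat.lt_succ_of_le hp), Finset.mul_sum, Complex.ofReal_sum]
    rw [Finset.sum_comm]
    refine Finset.sum_congr rfl fun r _ => Finset.sum_congr rfl fun s _ => ?_
    push_cast
    ring
  rw [hsum]
  refine Finset.sum_eq_zero fun r hr => ?_
  rw [hb.pow r i k, Complex.ofReal_zero, mul_zero]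
  refine lt_of_le_of_lt ?_ hik
  exact_mod_cast Nat.mul_le_mul_right b (Nat.lt_succ_iff.1 (Finset.mem_range.1 hr))

/-- Decay of the off-diagonal entries of the resolvent `(A + iω)⁻¹` of a banded matrix. -/
theorem norm_spectralEntry_resolvent_le {A : Matrix (Fin n) (Fin n) ℝ} (hU' : Uᵀ * U = 1)
    (hU : U * Uᵀ = 1) (hA : A = U * diagonal μ * Uᵀ) {β : ℕ} (hβ : 1 ≤ β) (hb : IsBanded A β)
    {a b ω α R : ℝ} (ha : 0 < a) (hab : a < b) (hμ : ∀ s, μ s ∈ Set.Icc a b)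
    (hα : α * (b - a) = ‖(a : ℂ) + Complex.I * ω‖ + ‖(b : ℂ) + Complex.I * ω‖)
    (hR : R = α + Real.sqrt (α ^ 2 - 1)) {i k : Fin n} (hik : k ≠ i) :
    ‖spectralEntry U μ (fun x => ((x : ℂ) + Complex.I * ω)⁻¹) i k‖
      ≤ 8 / (b - a) * (R ^ 2 / (R ^ 2 - 1) ^ 2) * (1 / R) ^ (scaledDist β k i - 1) := by
  have hd : 0 < b - a := by linarith
  have hR1 : 1 < R := by
    rw [hR]
    linarith [Real.sqrt_nonneg (α ^ 2 - 1), one_lt_of_mul_eq_norm_add_norm ha hab hα]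
  obtain ⟨d, hd0, hdi⟩ : ∃ d : ℕ, 0 < d ∧ (d : ℤ) = |((i : ℕ) : ℤ) - ((k : ℕ) : ℤ)| := by
    refine ⟨(((i : ℕ) : ℤ) - ((k : ℕ) : ℤ)).natAbs, ?_, Int.natCast_natAbs _⟩
    have : (i : ℕ) ≠ (k : ℕ) := fun h => hik (Fin.ext h.symm)
    omega
  -- m is the largest degree with mβ < d, which makes the (i,k) entry of p(A) vanish; maximality
  -- gives m ≥ d/β - 1, the exponent in the bound.
  obtain ⟨m, hmd, hdm⟩ : ∃ m : ℕ, m * β < d ∧ d ≤ (m + 1) * β := by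
    refine ⟨(d - 1) / β, ?_, ?_⟩
    · have := Nat.div_mul_le_self (d - 1) β
      omega
    · have := Nat.lt_div_mul_add (a := d - 1) (b := β) (by omega)
      rw [Nat.succ_mul]
      omega
  have hdist : scaledDist β k i - 1 ≤ (m : ℝ) := by
    have hβ' : (0 : ℝ) < β := by exact_mod_cast hβ
    have : |((k : ℕ) : ℝ) - ((i : ℕ) : ℝ)| = d := by
      rw [abs_sub_comm]
      exact_mod_cast hdi.symm
    rw [scaledDist, this, sub_le_iff_le_add, div_le_iff₀ hβ']
    exact_mod_cast hdm
  obtain ⟨p, hp, hap⟩ := exists_polynomial_approx_resolvent ha hab hα hR m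
  have hzero := spectralEntry_polynomial_eq_zero hU' hU hA hb hp (i := i) (k := k)
    (by rw [← hdi]; exact_mod_cast hmd)
  have hsub : spectralEntry U μ (fun x => ((x : ℂ) + Complex.I * ω)⁻¹) i k
      = spectralEntry U μ (fun x => ((x : ℂ) + Complex.I * ω)⁻¹ - p.eval (x : ℂ)) i k := by
    rw [← sub_zero (spectralEntry U μ (fun x => ((x : ℂ) + Complex.I * ω)⁻¹) i k), ← hzero]
    simp only [spectralEntry, mul_sub, Finset.sum_sub_distrib]
  have hpow : (1 / R) ^ m ≤ (1 / R) ^ (scaledDist β k i - 1) := by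
    rw [← Real.rpow_natCast]
    exact Real.rpow_le_rpow_of_exponent_ge (by positivity)
      ((div_le_one (by linarith)).2 hR1.le) hdist
  have hM : 0 ≤ 8 / (b - a) * (R ^ 2 / (R ^ 2 - 1) ^ 2) := by positivity
  have hbound : ‖spectralEntry U μ (fun x => ((x : ℂ) + Complex.I * ω)⁻¹ - p.eval (x : ℂ)) i k‖
      ≤ 8 / (b - a) * (R ^ 2 / (R ^ 2 - 1) ^ 2) * (1 / R) ^ m := by
    apply norm_spectralEntry_le hU
    · intro s
      exact hap _ (hμ s)
    · exact mul_nonneg hM (pow_nonneg (by positivity) m)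
  rw [hsub]
  exact hbound.trans (mul_le_mul_of_nonneg_left hpow hM)

theorem norm_spectralEntry_resolvent_le_inv_sqrt (hU : U * Uᵀ = 1) {a : ℝ} (ω : ℝ) (ha : 0 < a)
    (hμ : ∀ s, a ≤ μ s) (i k : Fin n) :
    ‖spectralEntry U μ (fun x => ((x : ℂ) + Complex.I * ω)⁻¹) i k‖
      ≤ 1 / Real.sqrt (a ^ 2 + ω ^ 2) := by
  refine norm_spectralEntry_le hU (fun s => ?_) (by positivity) i k
  rw [norm_inv, Complex.norm_ofReal_add_I_mul, one_div]
  have := hμ s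
  gcongr

end

/-! ### The integral representation of 1/(a + b). -/

theorem integrable_inv_sq_add_sq {a : ℝ} (ha : 0 < a) :
    Integrable fun ω : ℝ => (a ^ 2 + ω ^ 2)⁻¹ := by
  have h := (integrable_inv_one_add_sq.comp_div ha.ne').const_mul (a ^ 2)⁻¹
  refine h.congr (Filter.Eventually.of_forall fun ω => ?_)
  simp only
  rw [← mul_inv]
  congr 1
  field_simp

theorem integral_univ_div_sq_add_sq {a : ℝ} (ha : 0 < a) :
    ∫ ω : ℝ, a / (a ^ 2 + ω ^ 2) = Real.pi := by
  have h : (fun ω : ℝ => a / (a ^ 2 + ω ^ 2)) = fun ω => a⁻¹ * (1 + (ω / a) ^ 2)⁻¹ := by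
    funext ω
    field_simp
  rw [h, integral_const_mul, Measure.integral_comp_div (fun x : ℝ => (1 + x ^ 2)⁻¹) a,
    integral_univ_inv_one_add_sq, abs_of_pos ha, smul_eq_mul, inv_mul_cancel_left₀ ha.ne']

/-- The real part is (ab + ω²)/((a² + ω²)(b² + ω²)), which splits by partial fractions into two
Cauchy densities up to constants. -/
theorem re_resolvent_mul_conj {a b : ℝ} (ha : 0 < a) (hb : 0 < b) (ω : ℝ) :
    (((a : ℂ) + Complex.I * ω)⁻¹ * (starRingEnd ℂ) ((b : ℂ) + Complex.I * ω)⁻¹).re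
      = (a + b)⁻¹ * (a / (a ^ 2 + ω ^ 2) + b / (b ^ 2 + ω ^ 2)) := by
  have h1 : a ^ 2 + ω ^ 2 ≠ 0 := by positivity
  have h2 : b ^ 2 + ω ^ 2 ≠ 0 := by positivity
  have h3 : a + b ≠ 0 := by positivity
  have e1 : a * a + ω * ω = a ^ 2 + ω ^ 2 := by ring
  have e2 : b * b + ω * ω = b ^ 2 + ω ^ 2 := by ring
  simp only [Complex.mul_re, Complex.inv_re, Complex.inv_im, Complex.conj_re, Complex.conj_im,
    Complex.add_re, Complex.add_im, Complex.ofReal_re, Complex.ofReal_im, Complex.mul_im,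
    Complex.I_re, Complex.I_im, Complex.normSq_apply, zero_mul, one_mul, mul_zero, sub_zero,
    add_zero, zero_add, e1, e2]
  field_simp
  ring

theorem integrable_re_resolvent_mul_conj {a b : ℝ} (ha : 0 < a) (hb : 0 < b) :
    Integrable fun ω : ℝ =>
      (((a : ℂ) + Complex.I * ω)⁻¹ * (starRingEnd ℂ) ((b : ℂ) + Complex.I * ω)⁻¹).re := by
  simp only [re_resolvent_mul_conj ha hb, div_eq_mul_inv]
  exact (((integrable_inv_sq_add_sq ha).const_mul a).add
    ((integrable_inv_sq_add_sq hb).const_mul b)).const_mul _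

theorem integral_re_resolvent_mul_conj {a b : ℝ} (ha : 0 < a) (hb : 0 < b) :
    ∫ ω : ℝ, (((a : ℂ) + Complex.I * ω)⁻¹ * (starRingEnd ℂ) ((b : ℂ) + Complex.I * ω)⁻¹).re
      = 2 * Real.pi / (a + b) := by
  simp only [re_resolvent_mul_conj ha hb]
  rw [integral_const_mul, integral_add, integral_univ_div_sq_add_sq ha, integral_univ_div_sq_add_sq hb]
  · field_simp
    ring
  · exact (integrable_inv_sq_add_sq ha).const_mul a
  · exact (integrable_inv_sq_add_sq hb).const_mul b

/-! ### The kernel of the inverse Lyapunov operator. -/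

/-- The entries of the inverse of the Lyapunov operator `X ↦ AX + XA` for
`A = U diag(μ) Uᵀ`. -/
noncomputable def lyapunovKernel {n : ℕ} (U : Matrix (Fin n) (Fin n) ℝ) (μ : Fin n → ℝ)
    (i j k l : Fin n) : ℝ :=
  ∑ s, ∑ t, U i s * U k s * (U j t * U l t) / (μ s + μ t)

section

open Matrix

variable {n : ℕ} {U : Matrix (Fin n) (Fin n) ℝ} {μ : Fin n → ℝ}

/-- The coefficients formed from U are real, so they pass through the real part, and each pair (s,
t) reduces to the scalar integral 2π/(μ_s + μ_t). -/
theorem lyapunovKernel_eq_integral (hμ : ∀ s, 0 < μ s) (i j k l : Fin n) :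
    lyapunovKernel U μ i j k l = (2 * Real.pi)⁻¹ *
      ∫ ω : ℝ, (spectralEntry U μ (fun x => ((x : ℂ) + Complex.I * ω)⁻¹) i k *
        (starRingEnd ℂ) (spectralEntry U μ (fun x => ((x : ℂ) + Complex.I * ω)⁻¹) j l)).re := by
  have hexp : ∀ ω : ℝ, (spectralEntry U μ (fun x => ((x : ℂ) + Complex.I * ω)⁻¹) i k *
      (starRingEnd ℂ) (spectralEntry U μ (fun x => ((x : ℂ) + Complex.I * ω)⁻¹) j l)).re
      = ∑ s, ∑ t, U i s * U k s * (U j t * U l t) * ((((μ s : ℝ) : ℂ) + Complex.I * ω)⁻¹ *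
          (starRingEnd ℂ) (((μ t : ℝ) : ℂ) + Complex.I * ω)⁻¹).re := by
    intro ω
    simp only [spectralEntry, map_sum, Finset.sum_mul_sum, Complex.re_sum, map_mul,
      Complex.conj_ofReal]
    refine Finset.sum_congr rfl fun s _ => Finset.sum_congr rfl fun t _ => ?_
    rw [← Complex.re_ofReal_mul]
    congr 1
    push_cast
    ring
  simp only [hexp]
  rw [integral_finsetSum _ fun s _ => integrable_finsetSum _ fun t _ =>
    (integrable_re_resolvent_mul_conj (hμ s) (hμ t)).const_mul _]
  simp only [integral_finsetSum Finset.univ fun t _ =>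
    (integrable_re_resolvent_mul_conj (hμ _) (hμ t)).const_mul _, integral_const_mul,
    integral_re_resolvent_mul_conj (hμ _) (hμ _), Finset.mul_sum, lyapunovKernel]
  refine Finset.sum_congr rfl fun s _ => Finset.sum_congr rfl fun t _ => ?_
  have := hμ s
  have := hμ t
  field_simp

theorem abs_lyapunovKernel_le_integral (hμ : ∀ s, 0 < μ s) {i j k l : Fin n} {g h : ℝ → ℝ}
    (hg : ∀ ω : ℝ, ‖spectralEntry U μ (fun x => ((x : ℂ) + Complex.I * ω)⁻¹) i k‖ ≤ g ω)
    (hh : ∀ ω : ℝ, ‖spectralEntry U μ (fun x => ((x : ℂ) + Complex.I * ω)⁻¹) j l‖ ≤ h ω)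
    (hgh : Integrable fun ω => g ω * h ω) :
    |lyapunovKernel U μ i j k l| ≤ (2 * Real.pi)⁻¹ * ∫ ω, g ω * h ω := by
  rw [lyapunovKernel_eq_integral hμ, abs_mul, abs_of_pos (by positivity : 0 < (2 * Real.pi)⁻¹)]
  refine mul_le_mul_of_nonneg_left ?_ (by positivity)
  rw [← Real.norm_eq_abs]
  refine norm_integral_le_of_norm_le hgh (Filter.Eventually.of_forall fun ω => ?_)
  refine (Complex.abs_re_le_norm _).trans ?_
  rw [norm_mul, Complex.norm_conj]
  exact mul_le_mul (hg ω) (hh ω) (norm_nonneg _) ((norm_nonneg _).trans (hg ω))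

/-- Here all numerators are squares, so 1/(μ_s + μ_t) ≤ 1/(2a) and the unit rows of U suffice,
without the integral. -/
theorem abs_lyapunovKernel_diag_le (hU : U * Uᵀ = 1) {a : ℝ} (ha : 0 < a) (hμ : ∀ s, a ≤ μ s)
    (i j : Fin n) : |lyapunovKernel U μ i j i j| ≤ 1 / (2 * a) := by
  have hterm : ∀ s t, |U i s * U i s * (U j t * U j t) / (μ s + μ t)|
      ≤ U i s ^ 2 * U j t ^ 2 * (1 / (2 * a)) := by
    intro s t
    have h := hμ s
    have h' := hμ t
    rw [abs_of_nonneg (div_nonneg (mul_nonneg (mul_self_nonneg _) (mul_self_nonneg _))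
      (by linarith)), div_eq_mul_one_div, ← sq, ← sq]
    gcongr
    linarith
  calc |lyapunovKernel U μ i j i j|
      ≤ ∑ s, ∑ t, U i s ^ 2 * U j t ^ 2 * (1 / (2 * a)) :=
        (Finset.abs_sum_le_sum_abs _ _).trans (Finset.sum_le_sum fun s _ =>
          (Finset.abs_sum_le_sum_abs _ _).trans (Finset.sum_le_sum fun t _ => hterm s t))
    _ = 1 / (2 * a) := by
        simp only [← Finset.sum_mul, ← Finset.mul_sum, sum_sq_row_eq_one hU, mul_one, one_mul]

/-- Conjugation by U turns the equation into (μ_s + μ_t) Y_st = (UᵀDU)_st for Y = UᵀXU, and each μ_s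
+ μ_t is nonzero. -/
theorem lyapunov_iff_of_diagonalization {A X D : Matrix (Fin n) (Fin n) ℝ} (hU' : Uᵀ * U = 1)
    (hU : U * Uᵀ = 1) (hA : A = U * diagonal μ * Uᵀ) (hμ : ∀ s, 0 < μ s) :
    A * X + X * A = D ↔
      X = U * Matrix.of (fun s t => (Uᵀ * D * U) s t / (μ s + μ t)) * Uᵀ := by
  have hconj : ∀ Y Z : Matrix (Fin n) (Fin n) ℝ, Uᵀ * Y * U = Z ↔ Y = U * Z * Uᵀ := by
    intro Y Z
    constructor
    · rintro rfl
      calc Y = (U * Uᵀ) * Y * (U * Uᵀ) := by rw [hU, one_mul, mul_one]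
        _ = _ := by simp only [mul_assoc]
    · rintro rfl
      calc Uᵀ * (U * Z * Uᵀ) * U = (Uᵀ * U) * Z * (Uᵀ * U) := by simp only [mul_assoc]
        _ = Z := by rw [hU', one_mul, mul_one]
  have hlhs : Uᵀ * (A * X + X * A) * U
      = diagonal μ * (Uᵀ * X * U) + Uᵀ * X * U * diagonal μ := by
    calc Uᵀ * (A * X + X * A) * U
        = (Uᵀ * U) * diagonal μ * (Uᵀ * X * U) + Uᵀ * X * U * diagonal μ * (Uᵀ * U) := by
          rw [hA]; simp only [mul_add, add_mul, mul_assoc]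
      _ = _ := by rw [hU', one_mul, mul_one]
  have hsplit : A * X + X * A = D ↔ Uᵀ * (A * X + X * A) * U = Uᵀ * D * U := by
    refine ⟨fun h => by rw [h], fun h => ?_⟩
    exact ((hconj _ _).1 h).trans ((hconj D _).1 rfl).symm
  rw [hsplit, hlhs, ← hconj X, ← Matrix.ext_iff, ← Matrix.ext_iff]
  refine forall_congr' fun s => forall_congr' fun t => ?_
  have hst : μ s + μ t ≠ 0 := (add_pos (hμ s) (hμ t)).ne'
  rw [Matrix.add_apply, diagonal_mul, mul_diagonal, of_apply, eq_div_iff hst]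
  constructor <;> intro h <;> linear_combination h

theorem lyapunov_solution_apply (D : Matrix (Fin n) (Fin n) ℝ) (i j : Fin n) :
    (U * Matrix.of (fun s t => (Uᵀ * D * U) s t / (μ s + μ t)) * Uᵀ) i j
      = ∑ k, ∑ l, lyapunovKernel U μ i j k l * D k l := by
  have h1 : (U * Matrix.of (fun s t => (Uᵀ * D * U) s t / (μ s + μ t)) * Uᵀ) i j
      = ∑ t, ∑ s, ∑ l, ∑ k,
        U i s * U k s * (U j t * U l t) / (μ s + μ t) * D k l := by
    simp only [mul_apply, transpose_apply, of_apply, Finset.sum_mul, Finset.mul_sum,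
      Finset.sum_div]
    refine Finset.sum_congr rfl fun t _ => Finset.sum_congr rfl fun s _ =>
      Finset.sum_congr rfl fun l _ => Finset.sum_congr rfl fun k _ => ?_
    ring
  rw [h1]
  simp only [lyapunovKernel, Finset.sum_mul]
  calc _ = ∑ t, ∑ s, ∑ k, ∑ l, U i s * U k s * (U j t * U l t) / (μ s + μ t) * D k l :=
        Finset.sum_congr rfl fun t _ => Finset.sum_congr rfl fun s _ => Finset.sum_comm
    _ = ∑ k, ∑ t, ∑ s, ∑ l, U i s * U k s * (U j t * U l t) / (μ s + μ t) * D k l := by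
        rw [Finset.sum_comm]
        exact (Finset.sum_congr rfl fun t _ => Finset.sum_comm).trans
          ((Finset.sum_comm).trans (Finset.sum_congr rfl fun k _ => Finset.sum_comm))
    _ = _ := by
        refine Finset.sum_congr rfl fun k _ => ?_
        rw [Finset.sum_comm]
        exact (Finset.sum_congr rfl fun s _ => Finset.sum_comm).trans Finset.sum_comm

end

/-! ### Integrability of the weights. -/

section

variable {n : ℕ} {A : Matrix (Fin n) (Fin n) ℝ}

theorem alphaFun_mul_sub (hlam : lambdaMin A < lambdaMax A) (ω : ℝ) :
    alphaFun A ω * (lambdaMax A - lambdaMin A)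
      = ‖(lambdaMin A : ℂ) + Complex.I * ω‖ + ‖(lambdaMax A : ℂ) + Complex.I * ω‖ := by
  have hd : 0 < lambdaMax A - lambdaMin A := by linarith
  have hdn : ‖lambda2 A ω - lambda1 A ω‖ = lambdaMax A - lambdaMin A := by
    rw [lambda2, lambda1, add_sub_add_right_eq_sub, ← Complex.ofReal_sub,
      Complex.norm_of_nonneg hd.le]
  rw [alphaFun, hdn, div_mul_cancel₀ _ hd.ne', lambda1, lambda2]

theorem alphaFun_le_RFun (ω : ℝ) : alphaFun A ω ≤ RFun A ω :=
  le_add_of_nonneg_right (Real.sqrt_nonneg _)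

theorem one_lt_RFun (h0 : 0 < lambdaMin A) (hlam : lambdaMin A < lambdaMax A) (ω : ℝ) :
    1 < RFun A ω :=
  (one_lt_of_mul_eq_norm_add_norm h0 hlam (alphaFun_mul_sub hlam ω)).trans_le
    (alphaFun_le_RFun ω)

/-- R ≥ α, and dropping |λ₂| from α leaves |λ₁|/(λ_max - λ_min). Hence 1/R decays at least like
1/|ω|. -/
theorem one_div_RFun_le (h0 : 0 < lambdaMin A) (hlam : lambdaMin A < lambdaMax A) (ω : ℝ) :
    1 / RFun A ω ≤ (lambdaMax A - lambdaMin A) * (1 / Real.sqrt (lambdaMin A ^ 2 + ω ^ 2)) := by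
  have hd : 0 < lambdaMax A - lambdaMin A := by linarith
  have hs : 0 < Real.sqrt (lambdaMin A ^ 2 + ω ^ 2) := Real.sqrt_pos.2 (by positivity)
  have hR := one_lt_RFun h0 hlam ω
  have h := alphaFun_mul_sub hlam ω
  rw [Complex.norm_ofReal_add_I_mul] at h
  have hle := mul_le_mul_of_nonneg_right (alphaFun_le_RFun (A := A) ω) hd.le
  rw [← mul_div_assoc, mul_one, div_le_div_iff₀ (by linarith) hs]
  linarith [norm_nonneg ((lambdaMax A : ℂ) + Complex.I * ω)]

/-- Moduli dominate real parts, so R ≥ r > 1 uniformly in ω, with r the value of α at ω = 0. Hence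
R² - 1 is comparable to R², and the factor is O(R⁻²). -/
theorem exists_RFun_factor_le (h0 : 0 < lambdaMin A) (hlam : lambdaMin A < lambdaMax A) :
    ∃ M : ℝ, 0 ≤ M ∧ ∀ ω, RFun A ω ^ 2 / (RFun A ω ^ 2 - 1) ^ 2 ≤ M * (1 / RFun A ω) ^ (2 : ℝ) := by
  have hd : 0 < lambdaMax A - lambdaMin A := by linarith
  set r : ℝ := (lambdaMin A + lambdaMax A) / (lambdaMax A - lambdaMin A) with hr
  have hr1 : 1 < r := by
    rw [hr, one_lt_div hd]
    linarith
  have hrpos : 0 < 1 - 1 / r ^ 2 := by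
    rw [sub_pos, div_lt_one (by positivity)]
    nlinarith
  refine ⟨1 / (1 - 1 / r ^ 2) ^ 2, by positivity, fun ω => ?_⟩
  have hrR : r ≤ RFun A ω := by
    refine le_trans ?_ (alphaFun_le_RFun ω)
    rw [hr, div_le_iff₀ hd, alphaFun_mul_sub hlam ω]
    exact add_le_add (le_norm_ofReal_add_I_mul _ _) (le_norm_ofReal_add_I_mul _ _)
  have hR : 0 < RFun A ω := by linarith
  have hkey : (1 - 1 / r ^ 2) * RFun A ω ^ 2 ≤ RFun A ω ^ 2 - 1 := by
    have : 1 ≤ 1 / r ^ 2 * RFun A ω ^ 2 := by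
      rw [div_mul_eq_mul_div, one_mul, one_le_div (by positivity)]
      gcongr
    linarith
  calc RFun A ω ^ 2 / (RFun A ω ^ 2 - 1) ^ 2
      ≤ RFun A ω ^ 2 / ((1 - 1 / r ^ 2) * RFun A ω ^ 2) ^ 2 := by gcongr
    _ = _ := by
      rw [Real.rpow_two]
      have := hrpos.ne'
      field_simp

theorem measurable_RFun : Measurable (RFun A) := by
  have hα : Measurable (alphaFun A) := by
    unfold alphaFun lambda1 lambda2
    fun_prop
  exact hα.add ((hα.pow_const 2).sub_const 1).sqrt

theorem integrable_of_abs_le_const_mul_inv {f : ℝ → ℝ} (hf : Measurable f) {a M : ℝ} (ha : 0 < a)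
    (h : ∀ ω, |f ω| ≤ M * (1 / Real.sqrt (a ^ 2 + ω ^ 2)) ^ 2) : Integrable f := by
  refine ((integrable_inv_sq_add_sq ha).const_mul M).mono' hf.aestronglyMeasurable
    (Filter.Eventually.of_forall fun ω => (h ω).trans_eq ?_)
  rw [div_pow, Real.sq_sqrt (by positivity), one_pow, one_div]

theorem scaledDist_nonneg (b : ℕ) (p q : Fin n) : 0 ≤ scaledDist b p q := by
  unfold scaledDist
  positivity

/-- The exponent of 1/R can be negative but is at least -2. The squared prefactor supplies four
powers of 1/R, so at least two remain, which is an integrable decay. -/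
theorem integrable_integrandOff (h0 : 0 < lambdaMin A) (hlam : lambdaMin A < lambdaMax A) (b : ℕ)
    (i j k l : Fin n) : Integrable (integrandOff A b i j k l) := by
  obtain ⟨M, hM, hfac⟩ := exists_RFun_factor_le h0 hlam
  refine integrable_of_abs_le_const_mul_inv (a := lambdaMin A)
    (M := M ^ 2 * (lambdaMax A - lambdaMin A) ^ 2) ?_ h0 fun ω => ?_
  · have := measurable_RFun (A := A)
    unfold integrandOff
    fun_prop
  · have hR := one_lt_RFun h0 hlam ω
    have hx : 0 < 1 / RFun A ω := by positivity
    have hx1 : 1 / RFun A ω ≤ 1 := (div_le_one (by linarith)).2 hR.le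
    have hd1 := scaledDist_nonneg b k i
    have hd2 := scaledDist_nonneg b l j
    have hle := one_div_RFun_le h0 hlam ω
    unfold integrandOff
    rw [abs_of_nonneg (by positivity)]
    calc (RFun A ω ^ 2 / (RFun A ω ^ 2 - 1) ^ 2) ^ 2
          * (1 / RFun A ω) ^ (scaledDist b k i + scaledDist b l j - 2)
        ≤ (M * (1 / RFun A ω) ^ (2 : ℝ)) ^ 2
          * (1 / RFun A ω) ^ (scaledDist b k i + scaledDist b l j - 2) := by
          gcongr
          exact hfac ω
      _ = M ^ 2 * (1 / RFun A ω) ^ (2 + (2 + (scaledDist b k i + scaledDist b l j - 2))) := by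
          rw [Real.rpow_add hx, Real.rpow_add hx]
          ring
      _ ≤ M ^ 2 * (1 / RFun A ω) ^ (2 : ℝ) := by
          refine mul_le_mul_of_nonneg_left ?_ (by positivity)
          exact Real.rpow_le_rpow_of_exponent_ge hx hx1 (by linarith)
      _ ≤ M ^ 2 * ((lambdaMax A - lambdaMin A)
            * (1 / Real.sqrt (lambdaMin A ^ 2 + ω ^ 2))) ^ 2 := by
          rw [Real.rpow_two]
          gcongr
      _ = _ := by ring

/-- The exponent is at least -1 and the prefactor supplies two powers, so one power of 1/R remains;
the inverse square root supplies the second order of decay. -/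
theorem integrable_integrandOne (h0 : 0 < lambdaMin A) (hlam : lambdaMin A < lambdaMax A) (b : ℕ)
    (i j k l : Fin n) : Integrable (integrandOne A b i j k l) := by
  obtain ⟨M, hM, hfac⟩ := exists_RFun_factor_le h0 hlam
  refine integrable_of_abs_le_const_mul_inv (a := lambdaMin A)
    (M := M * (lambdaMax A - lambdaMin A)) ?_ h0 fun ω => ?_
  · have := measurable_RFun (A := A)
    unfold integrandOne
    fun_prop
  · have hR := one_lt_RFun h0 hlam ω
    have hx : 0 < 1 / RFun A ω := by positivity
    have hx1 : 1 / RFun A ω ≤ 1 := (div_le_one (by linarith)).2 hR.le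
    have hd1 := scaledDist_nonneg b k i
    have hd2 := scaledDist_nonneg b l j
    have hle := one_div_RFun_le h0 hlam ω
    unfold integrandOne
    rw [abs_of_nonneg (by positivity)]
    calc 1 / Real.sqrt (lambdaMin A ^ 2 + ω ^ 2) * (RFun A ω ^ 2 / (RFun A ω ^ 2 - 1) ^ 2)
          * (1 / RFun A ω) ^ (scaledDist b k i + scaledDist b l j - 1)
        ≤ 1 / Real.sqrt (lambdaMin A ^ 2 + ω ^ 2) * (M * (1 / RFun A ω) ^ (2 : ℝ))
          * (1 / RFun A ω) ^ (scaledDist b k i + scaledDist b l j - 1) := by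
          gcongr
          exact hfac ω
      _ = 1 / Real.sqrt (lambdaMin A ^ 2 + ω ^ 2)
          * (M * (1 / RFun A ω) ^ (2 + (scaledDist b k i + scaledDist b l j - 1))) := by
          rw [Real.rpow_add hx]
          ring
      _ ≤ 1 / Real.sqrt (lambdaMin A ^ 2 + ω ^ 2) * (M * (1 / RFun A ω) ^ (1 : ℝ)) := by
          refine mul_le_mul_of_nonneg_left (mul_le_mul_of_nonneg_left ?_ hM) (by positivity)
          exact Real.rpow_le_rpow_of_exponent_ge hx hx1 (by linarith)
      _ ≤ 1 / Real.sqrt (lambdaMin A ^ 2 + ω ^ 2) * (M * ((lambdaMax A - lambdaMin A)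
            * (1 / Real.sqrt (lambdaMin A ^ 2 + ω ^ 2)))) := by
          rw [Real.rpow_one]
          gcongr
      _ = _ := by ring

/-! ### Spectral data of A and the bound on the kernel. -/

open Matrix

theorem exists_real_diagonalization (hA : A.PosDef) :
    ∃ (U : Matrix (Fin n) (Fin n) ℝ) (μ : Fin n → ℝ), Uᵀ * U = 1 ∧ U * Uᵀ = 1 ∧
      A = U * diagonal μ * Uᵀ ∧ (∀ s, 0 < μ s) ∧ spectrum ℝ A = Set.range μ := by
  have hH := hA.isHermitian
  refine ⟨hH.eigenvectorUnitary, hH.eigenvalues, ?_, ?_, ?_, hA.eigenvalues_pos,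
    hH.spectrum_real_eq_range_eigenvalues⟩
  · have := Unitary.coe_star_mul_self hH.eigenvectorUnitary
    rwa [star_eq_conjTranspose, conjTranspose_eq_transpose_of_trivial] at this
  · have := Unitary.coe_mul_star_self hH.eigenvectorUnitary
    rwa [Unitary.coe_star, star_eq_conjTranspose, conjTranspose_eq_transpose_of_trivial] at this
  · have := hH.spectral_theorem
    rwa [Unitary.conjStarAlgAut_apply, star_eq_conjTranspose,
      conjTranspose_eq_transpose_of_trivial] at this

variable {U : Matrix (Fin n) (Fin n) ℝ} {μ : Fin n → ℝ}

theorem mem_Icc_lambda_of_spectrum_eq (hspec : spectrum ℝ A = Set.range μ) (s : Fin n) :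
    μ s ∈ Set.Icc (lambdaMin A) (lambdaMax A) := by
  rw [lambdaMin, lambdaMax, hspec]
  exact ⟨csInf_le (Set.finite_range μ).bddBelow ⟨s, rfl⟩,
    le_csSup (Set.finite_range μ).bddAbove ⟨s, rfl⟩⟩

theorem lambdaMin_pos_of_spectrum_eq (hspec : spectrum ℝ A = Set.range μ) (hμ : ∀ s, 0 < μ s)
    (hlam : lambdaMin A < lambdaMax A) : 0 < lambdaMin A := by
  have hne : (Set.range μ).Nonempty := by
    -- An empty spectrum would give both extremes the default value 0, against λ_min < λ_max.
    by_contra h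
    rw [Set.not_nonempty_iff_eq_empty] at h
    rw [lambdaMin, lambdaMax, hspec, h, Real.sInf_empty, Real.sSup_empty] at hlam
    exact lt_irrefl _ hlam
  rw [lambdaMin, hspec]
  obtain ⟨s, hs⟩ := hne.csInf_mem (Set.finite_range μ)
  rw [← hs]
  exact hμ s

theorem abs_lyapunovKernel_le_theta (hU' : Uᵀ * U = 1) (hU : U * Uᵀ = 1)
    (hA : A = U * diagonal μ * Uᵀ) (hμ : ∀ s, 0 < μ s) (hspec : spectrum ℝ A = Set.range μ)
    {β : ℕ} (hβ : 1 ≤ β) (hb : IsBanded A β) (hlam : lambdaMin A < lambdaMax A)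
    (i j k l : Fin n) : |lyapunovKernel U μ i j k l| ≤ theta A β i j k l := by
  have h0 := lambdaMin_pos_of_spectrum_eq hspec hμ hlam
  have hmem := mem_Icc_lambda_of_spectrum_eq hspec
  have hd : 0 < lambdaMax A - lambdaMin A := by linarith
  have hoff : ∀ {p q : Fin n}, q ≠ p → ∀ ω : ℝ, _ := fun {p q} hpq ω =>
    norm_spectralEntry_resolvent_le hU' hU hA hβ hb h0 hlam hmem (alphaFun_mul_sub hlam ω)
      (rfl : RFun A ω = _) hpq
  have hdiag := fun (p : Fin n) (ω : ℝ) =>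
    norm_spectralEntry_resolvent_le_inv_sqrt hU ω h0 (fun s => (hmem s).1) p p
  have hzero : ∀ p : Fin n, scaledDist β p p = 0 := fun p => by simp [scaledDist]
  have hx : ∀ ω, 0 < 1 / RFun A ω := fun ω =>
    one_div_pos.2 (by linarith [one_lt_RFun h0 hlam ω])
  unfold theta
  rw [abs_of_pos hd]
  split_ifs with h1 h2
  · obtain ⟨rfl, rfl⟩ := h1
    exact abs_lyapunovKernel_diag_le hU h0 (fun s => (hmem s).1) _ _
  · have hint := (integrable_integrandOne h0 hlam β i j k l).const_mul
      (8 / (lambdaMax A - lambdaMin A))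
    rcases h2 with rfl | rfl
    · have hlj : l ≠ j := fun h => h1 ⟨rfl, h⟩
      have heq : (fun ω => 8 / (lambdaMax A - lambdaMin A) * integrandOne A β k j k l ω) =
          fun ω => 1 / Real.sqrt (lambdaMin A ^ 2 + ω ^ 2) * (8 / (lambdaMax A - lambdaMin A) *
            (RFun A ω ^ 2 / (RFun A ω ^ 2 - 1) ^ 2) * (1 / RFun A ω) ^ (scaledDist β l j - 1)) := by
        funext ω
        rw [integrandOne, hzero, zero_add]
        ring
      have h := abs_lyapunovKernel_le_integral hμ (hdiag k) (hoff hlj) (heq ▸ hint)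
      rw [← heq, integral_const_mul] at h
      refine h.trans_eq ?_
      field_simp
    · have hki : k ≠ i := fun h => h1 ⟨h, rfl⟩
      have heq : (fun ω => 8 / (lambdaMax A - lambdaMin A) * integrandOne A β i l k l ω) =
          fun ω => (8 / (lambdaMax A - lambdaMin A) *
            (RFun A ω ^ 2 / (RFun A ω ^ 2 - 1) ^ 2) * (1 / RFun A ω) ^ (scaledDist β k i - 1)) *
            (1 / Real.sqrt (lambdaMin A ^ 2 + ω ^ 2)) := by
        funext ω
        rw [integrandOne, hzero, add_zero]
        ring
      have h := abs_lyapunovKernel_le_integral hμ (hoff hki) (hdiag l) (heq ▸ hint)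
      rw [← heq, integral_const_mul] at h
      refine h.trans_eq ?_
      field_simp
  · have hki : k ≠ i := fun h => h2 (Or.inl h)
    have hlj : l ≠ j := fun h => h2 (Or.inr h)
    have hint := (integrable_integrandOff h0 hlam β i j k l).const_mul
      (64 / (lambdaMax A - lambdaMin A) ^ 2)
    have heq : (fun ω => 64 / (lambdaMax A - lambdaMin A) ^ 2 * integrandOff A β i j k l ω) =
        fun ω => (8 / (lambdaMax A - lambdaMin A) *
          (RFun A ω ^ 2 / (RFun A ω ^ 2 - 1) ^ 2) * (1 / RFun A ω) ^ (scaledDist β k i - 1)) *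
          (8 / (lambdaMax A - lambdaMin A) *
          (RFun A ω ^ 2 / (RFun A ω ^ 2 - 1) ^ 2) * (1 / RFun A ω) ^ (scaledDist β l j - 1)) := by
      funext ω
      -- Both entries are off-diagonal: each brings its own factor 8/(λ_max - λ_min) and its own -1
      -- in the exponent, whence 64 and -2.
      rw [integrandOff, show scaledDist β k i + scaledDist β l j - 2
        = (scaledDist β k i - 1) + (scaledDist β l j - 1) by ring, Real.rpow_add (hx ω),
        show 64 / (lambdaMax A - lambdaMin A) ^ 2 = (8 / (lambdaMax A - lambdaMin A)) ^ 2 by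
          rw [div_pow]; norm_num]
      ring
    have h := abs_lyapunovKernel_le_integral hμ (hoff hki) (hoff hlj) (heq ▸ hint)
    rw [← heq, integral_const_mul] at h
    refine h.trans_eq ?_
    field_simp

end

theorem theorem2p2 {n : ℕ} (A D : Matrix (Fin n) (Fin n) ℝ) (βA βD : ℕ)
    (hA : A.PosDef) (hAband : IsBanded A βA) (hβA : 1 ≤ βA)
    (hD : D.IsSymm) (hDband : IsBanded D βD)
    (hlam : lambdaMin A < lambdaMax A) :
    (∃! X : Matrix (Fin n) (Fin n) ℝ, A * X + X * A = D) ∧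
    (∀ i j k l : Fin n,
      (k ≠ i ∧ l ≠ j → MeasureTheory.Integrable (integrandOff A βA i j k l)) ∧
      ((k = i ∧ l ≠ j) ∨ (k ≠ i ∧ l = j) →
        MeasureTheory.Integrable (integrandOne A βA i j k l))) ∧
    (∀ X : Matrix (Fin n) (Fin n) ℝ, A * X + X * A = D →
      ∀ i j : Fin n, |X i j| ≤ ∑ k : Fin n, ∑ l : Fin n, theta A βA i j k l * |D k l|) := by
  obtain ⟨U, μ, hU', hU, hAU, hμ, hspec⟩ := exists_real_diagonalization hA
  have h0 := lambdaMin_pos_of_spectrum_eq hspec hμ hlam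
  have hiff := fun X => lyapunov_iff_of_diagonalization (X := X) (D := D) hU' hU hAU hμ
  refine ⟨⟨_, (hiff _).2 rfl, fun X hX => (hiff X).1 hX⟩, fun i j k l =>
    ⟨fun _ => integrable_integrandOff h0 hlam βA i j k l,
      fun _ => integrable_integrandOne h0 hlam βA i j k l⟩, fun X hX i j => ?_⟩
  rw [(hiff X).1 hX, lyapunov_solution_apply]
  refine (Finset.abs_sum_le_sum_abs _ _).trans (Finset.sum_le_sum fun k _ =>
    (Finset.abs_sum_le_sum_abs _ _).trans (Finset.sum_le_sum fun l _ => ?_))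
  rw [abs_mul]
  exact mul_le_mul_of_nonneg_right
    (abs_lyapunovKernel_le_theta hU' hU hAU hμ hspec hβA hAband hlam i j k l) (abs_nonneg _)
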